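/- A \emph{formula} with $n$ Boolean variables and $m$ clauses is a list of $m$ clauses, each consisting of three literals. As a Max 3-XOR formula, a clause is satisfied when the exclusive or of its three literals is true; as a Max 3-AND formula, a clause is satisfied when all three literals are true. In the \emph{random $\beta$-unbalanced} formula with $n$ variables and $m$ clauses, all $3m$ literals are independent; each has a uniformly random variable and is negative with probability $\beta$ and positive with probability $1-\beta$. An assignment is \emph{$\gamma$-biased} if at most a $\gamma$ fraction of the variables is assigned $0$; a formula is \emph{$s$-satisfiable under $\gamma$-biased assignments} if some $\gamma$-biased assignment satisfies at least an $s$ fraction of its clauses. For $0<\gamma<\beta<1/2$ put $\alpha=\beta+\gamma-2\beta\gamma$ and consider the following two hypotheses. Conjecture 1 for $(\gamma,\beta)$: for every $\varepsilon>0$ there is $\Delta_0$ such that for every real constant $\Delta\ge\Delta_0$ there is no (deterministic) polynomial time algorithm that refutes most random $\beta$-unbalanced Max 3-XOR formulas with $n$ variables and $m=\lfloor\Delta n\rfloor$ clauses, but never refutes a Max 3-XOR formula that is $(1-\varepsilon)$-satisfiable under $\gamma$-biased assignments. Conjecture 2 for $(\gamma,\beta)$: for every $\varepsilon>0$ there is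 $\Delta_0$ such that for every real constant $\Delta\ge\Delta_0$ there is no (deterministic) polynomial time algorithm that refutes most random $\beta$-unbalanced Max 3-AND formulas with $n$ variables and $m=\lfloor\Delta n\rfloor$ clauses, but never refutes a Max 3-AND formula that is $(1-\frac32\alpha-\varepsilon)$-satisfiable under $\gamma$-biased assignments. Theorem 1. For all $0<\gamma<\beta<1/2$, Conjecture 1 for $(\gamma,\beta)$ implies Conjecture 2 for $(\gamma,\beta)$; in particular, if Conjecture 1 holds for all such pairs, then so does Conjecture 2. This is true under each of the following two readings (the same one in both conjectures) of "refutes most formulas": the probability of refuting the random formula tends to $1$ as $n\to\infty$; or there is $\delta>0$ such that this probability is at least $\frac12+\delta$ for all sufficiently large $n$. -/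

import Mathlib

open MeasureTheory Filter Topology

namespace UnbalancedCSP

/-- A literal over `n` Boolean variables: a variable together with a sign, `true` for the positive
literal of the variable and `false` for the negative one. -/
abbrev Literal (n : ℕ) : Type := Fin n × Bool

/-- A formula with `n` variables and `m` clauses, each clause containing exactly three literals
(a variable may occur more than once in a clause, and a clause more than once in the formula). -/
structure Formula where
  /-- number of variables -/
  n : ℕ
  /-- number of clauses -/
  m : ℕ
  /-- the three literals of each clause -/
  clause : Fin m → Fin 3 → Literal n

/-- Truth value of a literal under an assignment. -/
def Literal.val {n : ℕ} (ψ : Fin n → Bool) (l : Literal n) : Bool :=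
  if l.2 then ψ l.1 else !(ψ l.1)

/-- The predicate of Max 3-XOR. -/
def xor3 (b : Fin 3 → Bool) : Bool := xor (b 0) (xor (b 1) (b 2))

/-- The predicate of Max 3-AND. -/
def and3 (b : Fin 3 → Bool) : Bool := b 0 && b 1 && b 2

/-- Number of clauses of `φ` satisfied by `ψ`, when clauses are interpreted by the predicate `P`. -/
def satCount (P : (Fin 3 → Bool) → Bool) (φ : Formula) (ψ : Fin φ.n → Bool) : ℕ :=
  (Finset.univ.filter fun j : Fin φ.m => P (fun i => (φ.clause j i).val ψ) = true).card

/-- An assignment is `γ`-biased if at most a `γ` fraction of the variables is assigned `0`. -/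
def IsBiased {n : ℕ} (γ : ℝ) (ψ : Fin n → Bool) : Prop :=
  ((Finset.univ.filter fun v : Fin n => ψ v = false).card : ℝ) ≤ γ * n

/-- `φ` is `s`-satisfiable under `γ`-biased assignments: some `γ`-biased assignment satisfies at
least an `s` fraction of the clauses. -/
def IsSatisfiable (P : (Fin 3 → Bool) → Bool) (γ s : ℝ) (φ : Formula) : Prop :=
  ∃ ψ : Fin φ.n → Bool, IsBiased γ ψ ∧ s * φ.m ≤ satCount P φ ψ

/-- Law of a random literal: a uniformly random variable, and independently the negative sign
with probability `β`, the positive sign with probability `1 - β`. -/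
noncomputable def literalLaw (β : ℝ) (n : ℕ) : Measure (Literal n) :=
  (ProbabilityTheory.uniformOn (Set.univ : Set (Fin n))).prod
    (ENNReal.ofReal β • Measure.dirac false + ENNReal.ofReal (1 - β) • Measure.dirac true)

/-- Law of the random formula of imbalance `β` with `n` variables and `m` clauses: all `3m`
literals are independent. -/
noncomputable def formulaLaw (β : ℝ) (n m : ℕ) : Measure (Fin m → Fin 3 → Literal n) :=
  Measure.pi fun _ => Measure.pi fun _ => literalLaw β n

/-- Encoding of a formula as a word over a three-letter alphabet: the number of variables in unary
(letter `none`), then, clause after clause, every literal as its sign (letter `some s`) followed by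
the index of its variable in unary. The length of the word is polynomial in `n` and `m`, and at
least `n + 3m`. -/
def encodeFormula (φ : Formula) : List (Option Bool) :=
  List.replicate φ.n none ++
    (List.finRange φ.m).flatMap fun j => (List.finRange 3).flatMap fun i =>
      some (φ.clause j i).2 :: List.replicate ((φ.clause j i).1 : ℕ) none

/-- `A` is computed by a deterministic Turing machine in time polynomial in the input length. -/
def IsPolyTime (A : Formula → Bool) : Prop :=
  Nonempty (Turing.TM2ComputableInPolyTime encodeFormula Computability.encodeBool A)

/-- A sequence of probabilities that tends to one (`1 - o(1)`). -/
def AlmostAll (u : ℕ → ℝ) : Prop := Tendsto u atTop (𝓝 1)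

/-- A sequence of probabilities that eventually exceeds one half by a positive constant. -/
def Majority (u : ℕ → ℝ) : Prop := ∃ δ > 0, ∀ᶠ n in atTop, 1 / 2 + δ ≤ u n

/-- There is a polynomial time algorithm (answer `true` means "refuted") that refutes most random
formulas of imbalance `β` with `n` variables and `Δ n` clauses (rounded down), and that never
refutes a formula which is `s`-satisfiable under `γ`-biased assignments. The argument `most` says
which sequences of refutation probabilities (indexed by `n`) count as refuting most formulas. -/
def HasRefuter (most : (ℕ → ℝ) → Prop) (P : (Fin 3 → Bool) → Bool) (γ β s Δ : ℝ) : Prop :=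
  ∃ A : Formula → Bool, IsPolyTime A ∧
    (∀ φ : Formula, IsSatisfiable P γ s φ → A φ = false) ∧
    most fun n => (formulaLaw β n ⌊Δ * n⌋₊).real {c | A ⟨n, ⌊Δ * n⌋₊, c⟩ = true}

/-- Hardness of refuting random unbalanced Max 3-XOR, for imbalance `β` and bias `γ`. -/
def XorRefutationHard (most : (ℕ → ℝ) → Prop) (γ β : ℝ) : Prop :=
  ∀ ε : ℝ, 0 < ε → ∃ Δ₀ : ℝ, ∀ Δ : ℝ, Δ₀ ≤ Δ →
    ¬ HasRefuter most xor3 γ β (1 - ε) Δ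

/-- Hardness of refuting random unbalanced Max 3-AND, for imbalance `β` and bias `γ`; here
`α = β + γ - 2βγ`. -/
def AndRefutationHard (most : (ℕ → ℝ) → Prop) (γ β : ℝ) : Prop :=
  ∀ ε : ℝ, 0 < ε → ∃ Δ₀ : ℝ, ∀ Δ : ℝ, Δ₀ ≤ Δ →
    ¬ HasRefuter most and3 γ β (1 - 3 / 2 * (β + γ - 2 * β * γ) - ε) Δ

end UnbalancedCSP

/-! The contrapositive is proved: a refuter `A` for 3-AND yields a refuter for 3-XOR that says
"refuted" when a counting test `passes` succeeds and `A` refutes.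

In a satisfied XOR clause either no literal or exactly two literals are false. Hence an assignment
loses at most half as many clauses as it has false literals when XOR is replaced by AND
(`two_mul_satCount_xor3_le`). A random formula contains each positive literal about `3Δ(1-β)` times
and each negative one about `3Δβ` times. If all counts were exactly so, a `γ`-biased assignment
would make at most a fraction `γ(1-β) + (1-γ)β = α` of the literals false, and the loss would be at
most `3α/2` of the clauses.

Counts in a sparse formula do fluctuate, so the test bounds only the total surplus `excess` of
occurrences beyond the thresholds `T`. Passing bounds the false literals of every `γ`-biased
assignment (`falseCount_le_of_passes`), which gives soundness. A large surplus means that some set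
of literals is hit far too often. Hoeffding's inequality and a union bound over the `2^(2n)` sets
make this exponentially unlikely for large `Δ` (`formulaLaw_real_not_passes_le`), so the refutation
probability barely drops.

Polynomial time is shown on an explicit stack machine that performs the test with coins and then
starts the machine of `A` (`IsPolyTime.and_passes`). -/

namespace UnbalancedCSP

open Turing

/-! ### Reachability with a bound on the number of steps -/

/-- `b` is reached from `a` by at most `n` steps of the partial transition function `f`. -/
def ReachesWithin {C : Type*} (f : C → Option C) (n : ℕ) (a b : C) : Prop :=
  ∃ k ≤ n, (flip Bind.bind f)^[k] (some a) = some b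

namespace ReachesWithin

variable {C : Type*} {f : C → Option C} {a b c : C} {n k : ℕ}

theorem single (h : f a = some b) : ReachesWithin f 1 a b := ⟨1, le_rfl, h⟩

theorem mono (h : ReachesWithin f n a b) (hnk : n ≤ k) : ReachesWithin f k a b := by
  obtain ⟨j, hj, e⟩ := h
  exact ⟨j, hj.trans hnk, e⟩

theorem trans (h₁ : ReachesWithin f n a b) (h₂ : ReachesWithin f k b c) :
    ReachesWithin f (n + k) a c := by
  obtain ⟨i, hi, e₁⟩ := h₁
  obtain ⟨j, hj, e₂⟩ := h₂
  refine ⟨j + i, by omega, ?_⟩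
  rw [Function.iterate_add_apply, e₁, e₂]

theorem head (h₁ : f a = some b) (h₂ : ReachesWithin f n b c) : ReachesWithin f (n + 1) a c :=
  ((single h₁).trans h₂).mono (by omega)

end ReachesWithin

/-! ### Machines with additional stacks -/

section Stacks

variable {K W : Type} {Γ : K → Type} {Δ : W → Type}

/-- The stacks of a machine together with those of an additional family of stacks. -/
def joinStk (S : ∀ k, List (Γ k)) (T : ∀ w, List (Δ w)) :
    ∀ k : K ⊕ W, List (Sum.elim Γ Δ k)
  | Sum.inl k => S k
  | Sum.inr w => T w

@[simp] theorem joinStk_inl (S : ∀ k, List (Γ k)) (T : ∀ w, List (Δ w)) (k : K) :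
    joinStk S T (Sum.inl k) = S k := rfl

@[simp] theorem joinStk_inr (S : ∀ k, List (Γ k)) (T : ∀ w, List (Δ w)) (w : W) :
    joinStk S T (Sum.inr w) = T w := rfl

variable [DecidableEq K] [DecidableEq W]

@[simp] theorem update_joinStk_inl (S : ∀ k, List (Γ k)) (T : ∀ w, List (Δ w)) (k : K)
    (x : List (Γ k)) :
    Function.update (joinStk S T) (Sum.inl k) x = joinStk (Function.update S k x) T := by
  funext j
  rcases j with j | j
  · rcases eq_or_ne j k with rfl | h
    · exact (Function.update_self _ _ _).trans (by simp)
    · exact (Function.update_of_ne (by simpa using h) _ _).trans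
        (by simp [h])
  · exact Function.update_of_ne (by simp) _ _

@[simp] theorem update_joinStk_inr (S : ∀ k, List (Γ k)) (T : ∀ w, List (Δ w)) (w : W)
    (x : List (Δ w)) :
    Function.update (joinStk S T) (Sum.inr w) x = joinStk S (Function.update T w x) := by
  funext j
  rcases j with j | j
  · exact Function.update_of_ne (by simp) _ _
  · rcases eq_or_ne j w with rfl | h
    · exact (Function.update_self _ _ _).trans (by simp)
    · exact (Function.update_of_ne (by simpa using h) _ _).trans
        (by simp [h])

variable {Λ Λ' σ τ : Type}

/-- A statement, run on a machine with more stacks, more labels and more internal state. -/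
def liftStmt : TM2.Stmt Γ Λ σ → TM2.Stmt (Sum.elim Γ Δ) (Λ ⊕ Λ') (σ × τ)
  | .push k f q => .push (Sum.inl k) (fun v => f v.1) (liftStmt q)
  | .peek k f q => .peek (Sum.inl k) (fun v x => (f v.1 x, v.2)) (liftStmt q)
  | .pop k f q => .pop (Sum.inl k) (fun v x => (f v.1 x, v.2)) (liftStmt q)
  | .load a q => .load (fun v => (a v.1, v.2)) (liftStmt q)
  | .branch p q₁ q₂ => .branch (fun v => p v.1) (liftStmt q₁) (liftStmt q₂)
  | .goto l => .goto fun v => Sum.inl (l v.1)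
  | .halt => .halt

/-- A configuration, on a machine with more stacks, more labels and more internal state. -/
def liftCfg (t : τ) (T : ∀ w, List (Δ w)) (c : TM2.Cfg Γ Λ σ) :
    TM2.Cfg (Sum.elim Γ Δ) (Λ ⊕ Λ') (σ × τ) :=
  ⟨c.l.map Sum.inl, (c.var, t), joinStk c.stk T⟩

/-- Push on an additional stack. -/
def pushNew (w : W) (f : σ → Δ w) (s : TM2.Stmt (Sum.elim Γ Δ) Λ σ) :
    TM2.Stmt (Sum.elim Γ Δ) Λ σ := .push (Sum.inr w) f s

/-- Pop from an additional stack. -/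
def popNew (w : W) (f : σ → Option (Δ w) → σ) (s : TM2.Stmt (Sum.elim Γ Δ) Λ σ) :
    TM2.Stmt (Sum.elim Γ Δ) Λ σ := .pop (Sum.inr w) f s

/-- Look at the top of an additional stack. -/
def peekNew (w : W) (f : σ → Option (Δ w) → σ) (s : TM2.Stmt (Sum.elim Γ Δ) Λ σ) :
    TM2.Stmt (Sum.elim Γ Δ) Λ σ := .peek (Sum.inr w) f s

/-- Push on an original stack. -/
def pushOld (k : K) (f : σ → Γ k) (s : TM2.Stmt (Sum.elim Γ Δ) Λ σ) :
    TM2.Stmt (Sum.elim Γ Δ) Λ σ := .push (Sum.inl k) f s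

/-- Pop from an original stack. -/
def popOld (k : K) (f : σ → Option (Γ k) → σ) (s : TM2.Stmt (Sum.elim Γ Δ) Λ σ) :
    TM2.Stmt (Sum.elim Γ Δ) Λ σ := .pop (Sum.inl k) f s

section

variable (S : ∀ k, List (Γ k)) (T : ∀ w, List (Δ w)) (v : σ) (s : TM2.Stmt (Sum.elim Γ Δ) Λ σ)

theorem stepAux_pushNew (w : W) (f : σ → Δ w) :
    TM2.stepAux (pushNew w f s) v (joinStk S T) =
      TM2.stepAux s v (joinStk S (Function.update T w (f v :: T w))) := by
  rw [← update_joinStk_inr]; rfl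

theorem stepAux_popNew (w : W) (f : σ → Option (Δ w) → σ) :
    TM2.stepAux (popNew w f s) v (joinStk S T) =
      TM2.stepAux s (f v (T w).head?) (joinStk S (Function.update T w (T w).tail)) := by
  rw [← update_joinStk_inr]; rfl

theorem stepAux_peekNew (w : W) (f : σ → Option (Δ w) → σ) :
    TM2.stepAux (peekNew w f s) v (joinStk S T) =
      TM2.stepAux s (f v (T w).head?) (joinStk S T) := rfl

theorem stepAux_pushOld (k : K) (f : σ → Γ k) :
    TM2.stepAux (pushOld k f s) v (joinStk S T) =
      TM2.stepAux s v (joinStk (Function.update S k (f v :: S k)) T) := by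
  rw [← update_joinStk_inl]; rfl

theorem stepAux_popOld (k : K) (f : σ → Option (Γ k) → σ) :
    TM2.stepAux (popOld k f s) v (joinStk S T) =
      TM2.stepAux s (f v (S k).head?) (joinStk (Function.update S k (S k).tail) T) := by
  rw [← update_joinStk_inl]; rfl

end

theorem stepAux_liftStmt (q : TM2.Stmt Γ Λ σ) (v : σ) (t : τ) (S : ∀ k, List (Γ k))
    (T : ∀ w, List (Δ w)) :
    TM2.stepAux (liftStmt (Λ' := Λ') q) (v, t) (joinStk S T) =
      liftCfg t T (TM2.stepAux q v S) := by
  induction q generalizing v S with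
  | branch p q₁ q₂ ih₁ ih₂ =>
    simp only [liftStmt, TM2.stepAux]
    cases p v
    · exact ih₂ v S
    · exact ih₁ v S
  | push k f q ih => simp [liftStmt, TM2.stepAux, ih]
  | peek k f q ih => simp [liftStmt, TM2.stepAux, ih]
  | pop k f q ih => simp [liftStmt, TM2.stepAux, ih]
  | load a q ih => simp [liftStmt, TM2.stepAux, ih]
  | goto l => rfl
  | halt => rfl

/-- Lifted statements neither inspect nor alter the extra stacks and state, so lifting commutes with
every single step and the step count is unchanged. -/
theorem ReachesWithin.liftCfg {M : Λ → TM2.Stmt Γ Λ σ}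
    {M' : Λ ⊕ Λ' → TM2.Stmt (Sum.elim Γ Δ) (Λ ⊕ Λ') (σ × τ)}
    (hM : ∀ l, M' (Sum.inl l) = liftStmt (M l)) {n : ℕ} {a b : TM2.Cfg Γ Λ σ}
    (h : ReachesWithin (TM2.step M) n a b) (t : τ) (T : ∀ w, List (Δ w)) :
    ReachesWithin (TM2.step M') n (UnbalancedCSP.liftCfg t T a)
      (UnbalancedCSP.liftCfg t T b) := by
  have step (c : TM2.Cfg Γ Λ σ) : TM2.step M' (UnbalancedCSP.liftCfg t T c) =
      (TM2.step M c).map (UnbalancedCSP.liftCfg t T) := by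
    rcases c with ⟨_ | l, v, S⟩
    · rfl
    · simp only [UnbalancedCSP.liftCfg, Option.map_some, TM2.step, hM, stepAux_liftStmt]
  have iter (k : ℕ) (c : Option (TM2.Cfg Γ Λ σ)) :
      (flip Bind.bind (TM2.step M'))^[k] (c.map (UnbalancedCSP.liftCfg t T)) =
        ((flip Bind.bind (TM2.step M))^[k] c).map (UnbalancedCSP.liftCfg t T) := by
    induction k generalizing c with
    | zero => rfl
    | succ k ih =>
      rw [Function.iterate_succ_apply, Function.iterate_succ_apply, ← ih]
      congr 1
      cases c with
      | none => rfl
      | some c => exact step c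
  obtain ⟨k, hk, e⟩ := h
  have := iter k (some a)
  rw [e] at this
  exact ⟨k, hk, this⟩

end Stacks

/-! ### Initial and halting configurations -/

theorem initList_eq (tm : FinTM2) (s : List (tm.Γ tm.k₀)) :
    initList tm s = ⟨some tm.main, tm.initialState, Function.update (fun _ => []) tm.k₀ s⟩ := by
  unfold initList
  congr 1
  funext k
  by_cases h : k = tm.k₀
  · subst h; simp
  · simp [h]

/-- Halting requires the initial internal state and empty stacks apart from the output. The testing
machine therefore has to clean up after itself. -/
theorem haltList_eq (tm : FinTM2) (s : List (tm.Γ tm.k₁)) :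
    haltList tm s = ⟨none, tm.initialState, Function.update (fun _ => []) tm.k₁ s⟩ := by
  unfold haltList
  congr 1
  funext k
  by_cases h : k = tm.k₁
  · subst h; simp
  · simp [h]

theorem nonempty_outputsInTime_iff (tm : FinTM2) (x : List (tm.Γ tm.k₀)) (y : List (tm.Γ tm.k₁))
    (n : ℕ) : Nonempty (TM2OutputsInTime tm x (some y) n) ↔
      ReachesWithin (TM2.step tm.m) n (initList tm x) (haltList tm y) := by
  constructor
  · rintro ⟨h⟩
    exact ⟨h.steps, h.steps_le_m, h.evals_in_steps⟩
  · rintro ⟨k, hk, e⟩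
    exact ⟨⟨⟨k, e⟩, hk⟩⟩

end UnbalancedCSP

namespace UnbalancedCSP

open Turing

/-! ### A machine that runs a counting test before another machine -/

/-- The additional stacks of the testing machine. -/
inductive WorkStack
  | copy
  | work
  | count
  deriving DecidableEq

/-- The additional labels of the testing machine. -/
inductive Phase
  | read
  | restore
  | begin
  | scan
  | skip
  | back
  | clear
  | wipe
  deriving DecidableEq

instance : Fintype WorkStack where
  elems := {.copy, .work, .count}
  complete w := by cases w <;> simp

instance : Fintype Phase where
  elems := {.read, .restore, .begin, .scan, .skip, .back, .clear, .wipe}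
  complete l := by cases l <;> simp

/-- Contents of the additional stacks. -/
def workStk (x y z : List (Option Bool)) : WorkStack → List (Option Bool)
  | .copy => x
  | .work => y
  | .count => z

section workStk

variable (x y z a : List (Option Bool))

@[simp] theorem workStk_copy : workStk x y z .copy = x := rfl
@[simp] theorem workStk_work : workStk x y z .work = y := rfl
@[simp] theorem workStk_count : workStk x y z .count = z := rfl

@[simp] theorem update_workStk_copy :
    Function.update (workStk x y z) .copy a = workStk a y z := by
  funext w; cases w <;> simp

@[simp] theorem update_workStk_work :
    Function.update (workStk x y z) .work a = workStk x a z := by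
  funext w; cases w <;> simp

@[simp] theorem update_workStk_count :
    Function.update (workStk x y z) .count a = workStk x y a := by
  funext w; cases w <;> simp

end workStk

/-- The additional internal state: the last letter read, for each sign the number of occurrences of
the literal under consideration that are still free of charge, and whether all charges so far could
be paid. -/
abbrev Control (T : Bool → ℕ) : Type :=
  Option (Option Bool) × (∀ s, Fin (T s + 1)) × Bool

/-- The control state with full budgets. -/
def fullControl (T : Bool → ℕ) : Control T := (none, fun s => Fin.last (T s), true)

section Machine

variable (tm : FinTM2) (e : tm.Γ tm.k₀ ≃ Option Bool) (no : tm.Γ tm.k₁) (p q r : ℕ) (T : Bool → ℕ)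

/-- Statements of the testing machine. -/
abbrev TestStmt : Type :=
  TM2.Stmt (Sum.elim tm.Γ fun _ : WorkStack => Option Bool) (tm.Λ ⊕ Phase) (tm.σ × Control T)

variable {tm T}

/-- Pop `k` coins from the counting stack, recording whether there were enough. -/
def charge : ℕ → TestStmt tm T → TestStmt tm T
  | 0, s => s
  | k + 1, s =>
    popNew WorkStack.count (fun v x => (v.1, v.2.1, v.2.2.1, v.2.2.2 && x.isSome)) (charge k s)

/-- Push `k` coins to the counting stack. -/
def deposit : ℕ → TestStmt tm T → TestStmt tm T
  | 0, s => s
  | k + 1, s => pushNew WorkStack.count (fun _ => none) (deposit k s)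

/-- Jump to a phase of the test. -/
def enter (ph : Phase) : TestStmt tm T := .goto fun _ => Sum.inr ph

/-- The program of the test. -/
def testProgram : Phase → TestStmt tm T
  -- Every sign letter earns `r` coins, `3rm` in all. The stack `work` receives the word reversed,
  -- so the unary index of a literal comes to lie above its sign.
  | .read =>
    popOld tm.k₀ (fun v x => (v.1, x.map e, v.2.2)) <|
    .branch (fun v => v.2.1.isNone) (enter .restore) <|
    pushNew WorkStack.copy (fun v => v.2.1.getD none) <|
    pushNew WorkStack.work (fun v => v.2.1.getD none) <|
    .branch (fun v => v.2.1 == some none) (enter .read) (deposit r (enter .read))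
  | .restore =>
    popNew WorkStack.copy (fun v x => (v.1, x, v.2.2)) <|
    .branch (fun v => v.2.1.isNone) (enter .begin) <|
    pushOld tm.k₀ (fun v => e.symm (v.2.1.getD none)) (enter .restore)
  -- One round per variable: it costs `p` coins, resets the budgets and treats the variable that
  -- currently has index `0`.
  | .begin =>
    peekNew WorkStack.work (fun v x => (v.1, x, v.2.2)) <|
    .branch (fun v => v.2.1.isNone) (enter .clear) <|
    .load (fun v => (v.1, v.2.1, fun s => Fin.last (T s), v.2.2.2)) <|
    charge p (enter .scan)
  -- A sign with no blank before it belongs to variable `0`: it uses up budget, or costs `q` coins,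
  -- and disappears. A blank is dropped, which lowers the index of the next literal, or the number
  -- of trailing blanks, by one.
  | .scan =>
    popNew WorkStack.work (fun v x => (v.1, x, v.2.2)) <|
    .branch (fun v => v.2.1.isNone) (enter .back) <|
    .branch (fun v => v.2.1 == some none) (enter .skip) <|
    .branch (fun v => (v.2.2.1 ((v.2.1.getD none).getD true)).val == 0)
      (charge q (enter .scan))
      (.load (fun v => (v.1, v.2.1, Function.update v.2.2.1 ((v.2.1.getD none).getD true)
        ⟨(v.2.2.1 ((v.2.1.getD none).getD true)).val - 1, by omega⟩, v.2.2.2)) (enter .scan))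
  | .skip =>
    popNew WorkStack.work (fun v x => (v.1, x, v.2.2)) <|
    .branch (fun v => v.2.1.isNone) (enter .back) <|
    pushNew WorkStack.copy (fun v => v.2.1.getD none) <|
    .branch (fun v => v.2.1 == some none) (enter .skip) (enter .scan)
  | .back =>
    popNew WorkStack.copy (fun v x => (v.1, x, v.2.2)) <|
    .branch (fun v => v.2.1.isNone) (enter .begin) <|
    pushNew WorkStack.work (fun v => v.2.1.getD none) (enter .back)
  | .clear =>
    popNew WorkStack.count (fun v x => (v.1, x, v.2.2)) <|
    .branch (fun v => v.2.1.isSome) (enter .clear) <|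
    .branch (fun v => v.2.2.2)
      -- The control is reset here because the lifted machine never touches it again and must halt
      -- in the initial state.
      (.load (fun v => (v.1, fullControl T)) (.goto fun _ => Sum.inl tm.main)) (enter .wipe)
  | .wipe =>
    popOld tm.k₀ (fun v x => (v.1, x.map e, v.2.2)) <|
    .branch (fun v => v.2.1.isSome) (enter .wipe) <|
    .load (fun v => (v.1, fullControl T)) <|
    pushOld tm.k₁ (fun _ => no) .halt

variable (tm T)

/-- The machine that first runs the test, and then either answers `no` or runs `tm`. -/
def testMachine : FinTM2 where
  K := tm.K ⊕ WorkStack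
  kDecidableEq := inferInstance
  kFin := @instFintypeSum _ _ tm.kFin _
  k₀ := Sum.inl tm.k₀
  k₁ := Sum.inl tm.k₁
  Γ := Sum.elim tm.Γ fun _ => Option Bool
  Λ := tm.Λ ⊕ Phase
  main := Sum.inr .read
  ΛFin := @instFintypeSum _ _ tm.ΛFin _
  σ := tm.σ × Control T
  initialState := (tm.initialState, fullControl T)
  σFin := @instFintypeProd _ _ tm.σFin _
  Γk₀Fin := tm.Γk₀Fin
  m := Sum.elim (fun l => liftStmt (tm.m l)) (testProgram e no p q r)

/-- The transition function of `testMachine`. -/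
abbrev testStep := TM2.step
  (Sum.elim (fun l => liftStmt (tm.m l)) (testProgram e no p q r) : tm.Λ ⊕ Phase → TestStmt tm T)

variable {tm T}

/-- A configuration during the test, when `c` out of `R` coins have been charged. -/
def testCfg (ph : Phase) (a : Option (Option Bool)) (b : ∀ s, Fin (T s + 1)) (R c : ℕ)
    (u : List (tm.Γ tm.k₀)) (x y : List (Option Bool)) :
    TM2.Cfg (Sum.elim tm.Γ fun _ : WorkStack => Option Bool) (tm.Λ ⊕ Phase) (tm.σ × Control T) :=
  ⟨some (Sum.inr ph), (tm.initialState, a, b, decide (c ≤ R)),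
    joinStk (Function.update (fun _ => []) tm.k₀ u) (workStk x y (List.replicate (R - c) none))⟩

/-- A pop succeeds exactly while `c < R`. After overspending, the truncated `R - c` stays `0` and
the flag stays false, so the form of the configuration is preserved. -/
theorem stepAux_charge (k : ℕ) (s : TestStmt tm T) (v : tm.σ) (a : Option (Option Bool))
    (b : ∀ s, Fin (T s + 1)) (R c : ℕ) (S : ∀ k, List (tm.Γ k)) (x y : List (Option Bool)) :
    TM2.stepAux (charge k s) (v, a, b, decide (c ≤ R))
      (joinStk S (workStk x y (List.replicate (R - c) none))) =
    TM2.stepAux s (v, a, b, decide (c + k ≤ R))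
      (joinStk S (workStk x y (List.replicate (R - (c + k)) none))) := by
  induction k generalizing c with
  | zero => rfl
  | succ k ih =>
    have h : (decide (c ≤ R) && ((List.replicate (R - c) (none : Option Bool)).head?).isSome) =
        decide (c + 1 ≤ R) := by
      by_cases h : c + 1 ≤ R
      · obtain ⟨d, hd⟩ : ∃ d, R - c = d + 1 := ⟨R - c - 1, by omega⟩
        simp [hd, List.replicate_succ, h]; omega
      · have : R - c = 0 := by omega
        simp [this, h]
    have h' : (List.replicate (R - c) (none : Option Bool)).tail =
        List.replicate (R - (c + 1)) none := by
      rw [List.tail_replicate]; congr 1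
    simp only [charge, stepAux_popNew, workStk_count,
      update_workStk_count, h, h']
    rw [ih (c + 1)]
    simp only [Nat.add_assoc, Nat.add_comm 1 k]

theorem stepAux_deposit (k : ℕ) (s : TestStmt tm T) (v : tm.σ × Control T)
    (S : ∀ k, List (tm.Γ k)) (x y z : List (Option Bool)) :
    TM2.stepAux (deposit k s) v (joinStk S (workStk x y z)) =
      TM2.stepAux s v (joinStk S (workStk x y (List.replicate k none ++ z))) := by
  induction k generalizing z with
  | zero => rfl
  | succ k ih =>
    simp only [deposit, stepAux_pushNew, workStk_count,
      update_workStk_count, ih]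
    rw [List.replicate_succ', List.append_assoc]
    rfl

end Machine

end UnbalancedCSP

/-! ### Single transitions of the testing machine -/

namespace UnbalancedCSP

open Turing

section Steps

variable {tm : FinTM2} (e : tm.Γ tm.k₀ ≃ Option Bool) (no : tm.Γ tm.k₁) (p q r : ℕ) {T : Bool → ℕ}
  (a : Option (Option Bool)) (b : ∀ s, Fin (T s + 1)) (R c : ℕ) (u : List (tm.Γ tm.k₀))
  (x y : List (Option Bool)) (l : Option Bool)

attribute [local simp] stepAux_popNew stepAux_pushNew stepAux_peekNew stepAux_popOld
  stepAux_pushOld stepAux_charge stepAux_deposit enter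

theorem testStep_read_nil :
    testStep tm e no p q r T (testCfg .read a b R c [] x y) =
      some (testCfg .restore none b R c [] x y) := by
  change some (TM2.stepAux (testProgram e no p q r .read) _ _) = _
  simp [testProgram, testCfg]

/-- All deposits precede all charges. With `c = 0` the truncated subtraction in `testCfg` does no
harm. -/
theorem testStep_read_cons :
    testStep tm e no p q r T (testCfg .read a b R 0 (e.symm l :: u) x y) =
      some (testCfg .read (some l) b (R + if l = none then 0 else r) 0 u (l :: x) (l :: y)) := by
  change some (TM2.stepAux (testProgram e no p q r .read) _ _) = _
  rcases l with _ | s <;> simp [testProgram, testCfg, Nat.add_comm]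

theorem testStep_restore_nil :
    testStep tm e no p q r T (testCfg .restore a b R c u [] y) =
      some (testCfg .begin none b R c u [] y) := by
  change some (TM2.stepAux (testProgram e no p q r .restore) _ _) = _
  simp [testProgram, testCfg]

theorem testStep_restore_cons :
    testStep tm e no p q r T (testCfg .restore a b R c u (l :: x) y) =
      some (testCfg .restore (some l) b R c (e.symm l :: u) x y) := by
  change some (TM2.stepAux (testProgram e no p q r .restore) _ _) = _
  simp [testProgram, testCfg]

theorem testStep_begin_nil :
    testStep tm e no p q r T (testCfg .begin a b R c u x []) =
      some (testCfg .clear none b R c u x []) := by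
  change some (TM2.stepAux (testProgram e no p q r .begin) _ _) = _
  simp [testProgram, testCfg]

theorem testStep_begin_cons :
    testStep tm e no p q r T (testCfg .begin a b R c u x (l :: y)) =
      some (testCfg .scan (some l) (fun s => Fin.last (T s)) R (c + p) u x (l :: y)) := by
  change some (TM2.stepAux (testProgram e no p q r .begin) _ _) = _
  simp [testProgram, testCfg]

theorem testStep_scan_nil :
    testStep tm e no p q r T (testCfg .scan a b R c u x []) =
      some (testCfg .back none b R c u x []) := by
  change some (TM2.stepAux (testProgram e no p q r .scan) _ _) = _
  simp [testProgram, testCfg]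

theorem testStep_scan_none :
    testStep tm e no p q r T (testCfg .scan a b R c u x (none :: y)) =
      some (testCfg .skip (some none) b R c u x y) := by
  change some (TM2.stepAux (testProgram e no p q r .scan) _ _) = _
  simp [testProgram, testCfg]

theorem testStep_scan_some_of_eq_zero (s : Bool) (h : (b s).val = 0) :
    testStep tm e no p q r T (testCfg .scan a b R c u x (some s :: y)) =
      some (testCfg .scan (some (some s)) b R (c + q) u x y) := by
  change some (TM2.stepAux (testProgram e no p q r .scan) _ _) = _
  simp [testProgram, testCfg, h]

theorem testStep_scan_some_of_ne_zero (s : Bool) (h : (b s).val ≠ 0) :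
    testStep tm e no p q r T (testCfg .scan a b R c u x (some s :: y)) =
      some (testCfg .scan (some (some s))
        (Function.update b s ⟨(b s).val - 1, by omega⟩) R c u x y) := by
  change some (TM2.stepAux (testProgram e no p q r .scan) _ _) = _
  have h' : ((b s).val == 0) = false := by simpa using h
  simp [testProgram, testCfg, h']

theorem testStep_skip_nil :
    testStep tm e no p q r T (testCfg .skip a b R c u x []) =
      some (testCfg .back none b R c u x []) := by
  change some (TM2.stepAux (testProgram e no p q r .skip) _ _) = _
  simp [testProgram, testCfg]

theorem testStep_skip_none :
    testStep tm e no p q r T (testCfg .skip a b R c u x (none :: y)) =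
      some (testCfg .skip (some none) b R c u (none :: x) y) := by
  change some (TM2.stepAux (testProgram e no p q r .skip) _ _) = _
  simp [testProgram, testCfg]

theorem testStep_skip_some (s : Bool) :
    testStep tm e no p q r T (testCfg .skip a b R c u x (some s :: y)) =
      some (testCfg .scan (some (some s)) b R c u (some s :: x) y) := by
  change some (TM2.stepAux (testProgram e no p q r .skip) _ _) = _
  simp [testProgram, testCfg]

theorem testStep_back_nil :
    testStep tm e no p q r T (testCfg .back a b R c u [] y) =
      some (testCfg .begin none b R c u [] y) := by
  change some (TM2.stepAux (testProgram e no p q r .back) _ _) = _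
  simp [testProgram, testCfg]

theorem testStep_back_cons :
    testStep tm e no p q r T (testCfg .back a b R c u (l :: x) y) =
      some (testCfg .back (some l) b R c u x (l :: y)) := by
  change some (TM2.stepAux (testProgram e no p q r .back) _ _) = _
  simp [testProgram, testCfg]

/-- Emptying the counting stack, and then branching on the outcome of the test. -/
theorem reachesWithin_clear (z : List (Option Bool)) (ok : Bool) (S : ∀ k, List (tm.Γ k)) :
    ReachesWithin (testStep tm e no p q r T) (z.length + 1)
      ⟨some (Sum.inr .clear), (tm.initialState, a, b, ok), joinStk S (workStk x y z)⟩
      (cond ok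
        ⟨some (Sum.inl tm.main), (tm.initialState, fullControl T), joinStk S (workStk x y [])⟩
        ⟨some (Sum.inr .wipe), (tm.initialState, none, b, ok), joinStk S (workStk x y [])⟩) := by
  induction z generalizing a with
  | nil =>
    refine .single ?_
    change some (TM2.stepAux (testProgram e no p q r .clear) _ _) = _
    cases ok <;> simp [testProgram]
  | cons l z ih =>
    refine .head ?_ (ih (some l))
    change some (TM2.stepAux (testProgram e no p q r .clear) _ _) = _
    simp [testProgram]

/-- Emptying the input stack, and then halting with the negative answer. -/
theorem reachesWithin_wipe (ok : Bool) (W : WorkStack → List (Option Bool)) :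
    ReachesWithin (testStep tm e no p q r T) (u.length + 1)
      ⟨some (Sum.inr .wipe), (tm.initialState, a, b, ok),
        joinStk (Function.update (fun _ => []) tm.k₀ u) W⟩
      ⟨none, (tm.initialState, fullControl T),
        joinStk (Function.update (fun _ => []) tm.k₁ [no]) W⟩ := by
  induction u generalizing a with
  | nil =>
    refine .single ?_
    change some (TM2.stepAux (testProgram e no p q r .wipe) _ _) = _
    simp [testProgram]
  | cons g u ih =>
    refine .head ?_ (ih (some (e g)))
    change some (TM2.stepAux (testProgram e no p q r .wipe) _ _) = _
    simp [testProgram]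

end Steps

end UnbalancedCSP

namespace UnbalancedCSP

open Turing

/-! ### The test on words -/

/-- The reversed encoding of the list of literals `L`, followed by `n` blanks. -/
def revWord (L : List (ℕ × Bool)) (n : ℕ) : List (Option Bool) :=
  (L.flatMap fun x => List.replicate x.1 none ++ [some x.2]) ++ List.replicate n none

/-- Remove the literals of variable `0`, and decrease the indices of the other ones. -/
def shiftLits (L : List (ℕ × Bool)) : List (ℕ × Bool) :=
  L.filterMap fun x => if x.1 = 0 then none else some (x.1 - 1, x.2)

/-- The number of literals of variable `0` beyond the budgets `b`. -/
def zeroExcess (b : Bool → ℕ) (L : List (ℕ × Bool)) : ℕ := ∑ s, (L.count (0, s) - b s)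

@[simp] theorem revWord_cons (x : ℕ × Bool) (L : List (ℕ × Bool)) (n : ℕ) :
    revWord (x :: L) n = List.replicate x.1 none ++ some x.2 :: revWord L n := by
  simp [revWord]

@[simp] theorem revWord_nil (n : ℕ) : revWord [] n = List.replicate n none := by
  simp [revWord]

@[simp] theorem shiftLits_nil : shiftLits [] = [] := rfl

@[simp] theorem shiftLits_cons_zero (s : Bool) (L : List (ℕ × Bool)) :
    shiftLits ((0, s) :: L) = shiftLits L := by simp [shiftLits]

@[simp] theorem shiftLits_cons_succ (i : ℕ) (s : Bool) (L : List (ℕ × Bool)) :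
    shiftLits ((i + 1, s) :: L) = (i, s) :: shiftLits L := by simp [shiftLits]

/-- Makes the charges of successive rounds add up to the sum over all variables of the original
list. -/
theorem count_shiftLits (v : ℕ) (s : Bool) (L : List (ℕ × Bool)) :
    (shiftLits L).count (v, s) = L.count (v + 1, s) := by
  induction L with
  | nil => rfl
  | cons x L ih =>
    obtain ⟨_ | i, t⟩ := x
    · simp [ih]
    · simp [ih, List.count_cons]

theorem lt_of_mem_shiftLits {n : ℕ} {L : List (ℕ × Bool)} (h : ∀ x ∈ L, x.1 < n + 1)
    {x : ℕ × Bool} (hx : x ∈ shiftLits L) : x.1 < n := by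
  obtain ⟨y, hy, e⟩ := List.mem_filterMap.1 hx
  have := h y hy
  split_ifs at e with h0
  cases e
  simp only
  omega

theorem length_revWord_shiftLits_le (n : ℕ) (L : List (ℕ × Bool)) :
    (revWord (shiftLits L) (n - 1)).length ≤ (revWord L n).length := by
  induction L with
  | nil => simp
  | cons x L ih =>
    obtain ⟨_ | i, t⟩ := x
    · simp; omega
    · simp; omega

theorem zeroExcess_cons_succ (b : Bool → ℕ) (i : ℕ) (s : Bool) (L : List (ℕ × Bool)) :
    zeroExcess b ((i + 1, s) :: L) = zeroExcess b L := by
  simp [zeroExcess]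

theorem zeroExcess_cons_zero_of_eq_zero (b : Bool → ℕ) (s : Bool) (h : b s = 0)
    (L : List (ℕ × Bool)) : zeroExcess b ((0, s) :: L) = zeroExcess b L + 1 := by
  cases s <;> simp [zeroExcess, h, List.count_cons] <;> omega

theorem zeroExcess_cons_zero_of_ne_zero (b b' : Bool → ℕ) (s : Bool) (h : b s ≠ 0)
    (hb : b' = Function.update b s (b s - 1)) (L : List (ℕ × Bool)) :
    zeroExcess b ((0, s) :: L) = zeroExcess b' L := by
  subst hb
  cases s <;> simp [zeroExcess, List.count_cons] <;> omega

/-! ### Runs of the testing machine, phase by phase -/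

section Runs

variable {tm : FinTM2} (e : tm.Γ tm.k₀ ≃ Option Bool) (no : tm.Γ tm.k₁) (p q r : ℕ) {T : Bool → ℕ}
  (a : Option (Option Bool)) (b : ∀ s, Fin (T s + 1)) (R c : ℕ) (u : List (tm.Γ tm.k₀))
  (x y : List (Option Bool))

theorem reachesWithin_read (w : List (Option Bool)) :
    ReachesWithin (testStep tm e no p q r T) (w.length + 1)
      (testCfg .read a b R 0 (w.map e.symm) x y)
      (testCfg .restore none b (R + r * w.countP Option.isSome) 0 [] (w.reverse ++ x)
        (w.reverse ++ y)) := by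
  induction w generalizing a R x y with
  | nil => exact .single (testStep_read_nil ..)
  | cons l w ih =>
    refine .head (testStep_read_cons ..) ?_
    convert! ih (some l) (R + if l = none then 0 else r) (l :: x) (l :: y) using 2
    · cases l <;> simp; ring
    · simp
    · simp

theorem reachesWithin_restore :
    ReachesWithin (testStep tm e no p q r T) (x.length + 1)
      (testCfg .restore a b R c u x y)
      (testCfg .begin none b R c (x.reverse.map e.symm ++ u) [] y) := by
  induction x generalizing a u with
  | nil => exact .single (testStep_restore_nil ..)
  | cons l x ih =>
    refine .head (testStep_restore_cons ..) ?_
    convert! ih (some l) (e.symm l :: u) using 2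
    simp

theorem reachesWithin_back :
    ReachesWithin (testStep tm e no p q r T) (x.length + 1)
      (testCfg .back a b R c u x y)
      (testCfg .begin none b R c u [] (x.reverse ++ y)) := by
  induction x generalizing a y with
  | nil => exact .single (testStep_back_nil ..)
  | cons l x ih =>
    refine .head (testStep_back_cons ..) ?_
    convert! ih (some l) (l :: y) using 2
    simp

theorem reachesWithin_skip_literal (i : ℕ) (s : Bool) :
    ReachesWithin (testStep tm e no p q r T) (i + 1)
      (testCfg .skip a b R c u x (List.replicate i none ++ some s :: y))
      (testCfg .scan (some (some s)) b R c u (some s :: (List.replicate i none ++ x)) y) := by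
  induction i generalizing a x with
  | zero => exact .single (testStep_skip_some ..)
  | succ i ih =>
    refine .head (testStep_skip_none ..) ?_
    convert! ih (some none) (none :: x) using 2
    simp [List.replicate_succ']

theorem reachesWithin_skip_blanks (n : ℕ) :
    ReachesWithin (testStep tm e no p q r T) (n + 1)
      (testCfg .skip a b R c u x (List.replicate n none))
      (testCfg .back none b R c u (List.replicate n none ++ x) []) := by
  induction n generalizing a x with
  | zero => exact .single (testStep_skip_nil ..)
  | succ i ih =>
    refine .head (testStep_skip_none ..) ?_
    convert! ih (some none) (none :: x) using 2
    simp [List.replicate_succ']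

theorem reachesWithin_scan (n : ℕ) (L : List (ℕ × Bool)) :
    ∃ b' : ∀ s, Fin (T s + 1),
      ReachesWithin (testStep tm e no p q r T) ((revWord L n).length + 1)
        (testCfg .scan a b R c u x (revWord L n))
        (testCfg .back none b' R (c + q * zeroExcess (fun s => b s) L) u
          ((revWord (shiftLits L) (n - 1)).reverse ++ x) []) := by
  induction L generalizing a b c x with
  | nil =>
    refine ⟨b, ?_⟩
    -- If trailing blanks remain, one is dropped and the others are copied; if there are none, the
    -- scan stops at once. Both agree with `n - 1`.
    rcases n with _ | n
    · exact .single (by simpa [zeroExcess] using testStep_scan_nil ..)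
    · have h := ReachesWithin.head (testStep_scan_none e no p q r a b R c u x
        (List.replicate n none)) (reachesWithin_skip_blanks e no p q r (some none) b R c u x n)
      simpa [zeroExcess, List.replicate_succ] using h
  | cons l L ih =>
    obtain ⟨_ | i, s⟩ := l
    · by_cases h : (b s).val = 0
      · obtain ⟨b', h'⟩ := ih (some (some s)) b (c + q) x
        have h₁ := ReachesWithin.head
          (testStep_scan_some_of_eq_zero e no p q r a b R c u x (revWord L n) s h) h'
        refine ⟨b', ?_⟩
        convert! h₁ using 2
        · rw [zeroExcess_cons_zero_of_eq_zero _ _ h]; ring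
      · obtain ⟨b', h'⟩ := ih (some (some s))
          (Function.update b s ⟨(b s).val - 1, by omega⟩) c x
        have h₁ := ReachesWithin.head
          (testStep_scan_some_of_ne_zero e no p q r a b R c u x (revWord L n) s h) h'
        refine ⟨b', ?_⟩
        convert! h₁ using 2
        · rw [zeroExcess_cons_zero_of_ne_zero _ _ _ h]
          funext t
          rcases eq_or_ne t s with rfl | hts
          · simp
          · simp [hts]
    · obtain ⟨b', h'⟩ := ih (some (some s)) b c (some s :: (List.replicate i none ++ x))
      refine ⟨b', ?_⟩
      have h₁ := ReachesWithin.head (testStep_scan_none e no p q r a b R c u x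
        (List.replicate i none ++ some s :: revWord L n))
        (reachesWithin_skip_literal e no p q r (some none) b R c u x (revWord L n) i s)
      convert! h₁.trans h' using 1
      · simp; omega
      · simp [List.replicate_succ]
      · simp [zeroExcess_cons_succ]

theorem reachesWithin_round (n : ℕ) (L : List (ℕ × Bool)) :
    ∃ b' : ∀ s, Fin (T s + 1),
      ReachesWithin (testStep tm e no p q r T) (2 * (revWord L (n + 1)).length + 3)
        (testCfg .begin a b R c u [] (revWord L (n + 1)))
        (testCfg .begin none b' R (c + p + q * zeroExcess T L) u []
          (revWord (shiftLits L) n)) := by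
  -- A trailing blank is left, so `begin` starts a round even if no literals remain.
  obtain ⟨l, w, hw⟩ : ∃ l w, revWord L (n + 1) = l :: w :=
    List.exists_cons_of_ne_nil (by simp [revWord])
  obtain ⟨b', h⟩ := reachesWithin_scan e no p q r (some l) (fun s => Fin.last (T s)) R (c + p) u []
    (n + 1) L
  have h' := h.trans (reachesWithin_back ..)
  rw [hw] at h'
  have := ReachesWithin.head (testStep_begin_cons e no p q r a b R c u [] w l) h'
  rw [← hw] at this
  refine ⟨b', ?_⟩
  simp only [List.append_nil, List.reverse_reverse, Nat.add_sub_cancel, List.length_reverse,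
    Fin.val_last] at this
  refine this.mono ?_
  have := length_revWord_shiftLits_le (n + 1) L
  simp only [Nat.add_sub_cancel] at this
  omega

/-- Each round shortens the range of indices by one. When it is empty so is the word, and `begin`
moves on to `clear`. Words never grow, so `N` bounds the cost of every round. -/
theorem reachesWithin_rounds (N n : ℕ) (L : List (ℕ × Bool)) (hL : ∀ x ∈ L, x.1 < n)
    (hN : (revWord L n).length ≤ N) :
    ∃ b' : ∀ s, Fin (T s + 1),
      ReachesWithin (testStep tm e no p q r T) (n * (2 * N + 3) + 1)
        (testCfg .begin a b R c u [] (revWord L n))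
        (testCfg .clear none b' R
          (c + (p * n + q * ∑ v ∈ Finset.range n, ∑ s, (L.count (v, s) - T s))) u [] []) := by
  induction n generalizing a b c L with
  | zero =>
    obtain rfl : L = [] := List.eq_nil_iff_forall_not_mem.2 fun x hx => by simpa using hL x hx
    exact ⟨b, by simpa using ReachesWithin.single (testStep_begin_nil e no p q r a b R c u [])⟩
  | succ n ih =>
    obtain ⟨b₁, h₁⟩ := reachesWithin_round e no p q r a b R c u n L
    have hle := length_revWord_shiftLits_le (n + 1) L
    obtain ⟨b₂, h₂⟩ := ih none b₁ (c + p + q * zeroExcess T L) (shiftLits L)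
      (fun x hx => lt_of_mem_shiftLits hL hx) (hle.trans hN)
    refine ⟨b₂, ?_⟩
    have h := h₁.trans h₂
    simp only [count_shiftLits] at h
    rw [Finset.sum_range_succ']
    convert! h.mono (k := (n + 1) * (2 * N + 3) + 1) (by nlinarith) using 2
    unfold zeroExcess
    ring

end Runs

end UnbalancedCSP

namespace UnbalancedCSP

open Turing

/-! ### The test on formulas -/

/-- The number of occurrences of a literal in a formula. -/
def occ (φ : Formula) (l : Literal φ.n) : ℕ :=
  (Finset.univ.filter fun x : Fin φ.m × Fin 3 => φ.clause x.1 x.2 = l).card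

/-- The number of literals of a formula beyond the first `T true` occurrences of every positive and
the first `T false` occurrences of every negative literal. -/
def excess (T : Bool → ℕ) (φ : Formula) : ℕ := ∑ l : Literal φ.n, (occ φ l - T l.2)

/-- The list of all literals of a formula, with variables as natural numbers. -/
def litList (φ : Formula) : List (ℕ × Bool) :=
  (List.finRange φ.m).flatMap fun j => (List.finRange 3).map fun i =>
    (((φ.clause j i).1 : ℕ), (φ.clause j i).2)

theorem encodeFormula_eq (φ : Formula) : encodeFormula φ = List.replicate φ.n none ++
    (litList φ).flatMap fun x => some x.2 :: List.replicate x.1 none := by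
  simp only [encodeFormula, litList, List.flatMap_assoc, List.flatMap_map]

theorem reverse_encodeFormula (φ : Formula) :
    (encodeFormula φ).reverse = revWord (litList φ).reverse φ.n := by
  rw [encodeFormula_eq, revWord, List.reverse_append, List.reverse_replicate, List.reverse_flatMap]
  congr 2
  funext x
  simp

theorem countP_isSome_encodeFormula (φ : Formula) :
    (encodeFormula φ).countP Option.isSome = 3 * φ.m := by
  have h (L : List (ℕ × Bool)) : (L.flatMap fun x => some x.2 :: List.replicate x.1 none).countP
      Option.isSome = L.length := by
    induction L with
    | nil => rfl
    | cons x L ih => simp [ih, List.countP_replicate]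
  rw [encodeFormula_eq, List.countP_append, h]
  simp [litList, List.countP_replicate, mul_comm]

theorem count_litList (φ : Formula) (l : Literal φ.n) :
    (litList φ).count ((l.1 : ℕ), l.2) = occ φ l := by
  rw [occ, Finset.card_filter, Fintype.sum_prod_type, litList, List.count_flatMap, ← Fin.sum_univ_def]
  refine Finset.sum_congr rfl fun j _ => ?_
  have h (i : Fin 3) : (((φ.clause j i).1 : ℕ), (φ.clause j i).2) = ((l.1 : ℕ), l.2) ↔
      φ.clause j i = l := by
    simp [Prod.ext_iff, Fin.ext_iff]
  rw [Fin.sum_univ_three]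
  simp [List.finRange_succ, List.count_cons, h, -Prod.mk.injEq]
  ring

theorem lt_of_mem_litList (φ : Formula) {x : ℕ × Bool} (hx : x ∈ litList φ) : x.1 < φ.n := by
  simp only [litList, List.mem_flatMap, List.mem_map] at hx
  obtain ⟨j, -, i, -, rfl⟩ := hx
  exact (φ.clause j i).1.isLt

theorem sum_count_litList (T : Bool → ℕ) (φ : Formula) :
    ∑ v ∈ Finset.range φ.n, ∑ s, ((litList φ).reverse.count (v, s) - T s) = excess T φ := by
  rw [Finset.sum_range, excess, Fintype.sum_prod_type]
  refine Finset.sum_congr rfl fun v _ => Finset.sum_congr rfl fun s _ => ?_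
  rw [List.count_reverse, ← count_litList]

/-- The outcome of the test. -/
def passes (p q r : ℕ) (T : Bool → ℕ) (φ : Formula) : Prop :=
  p * φ.n + q * excess T φ ≤ r * (3 * φ.m)

instance (p q r : ℕ) (T : Bool → ℕ) (φ : Formula) : Decidable (passes p q r T φ) :=
  inferInstanceAs (Decidable (_ ≤ _))

/-! ### The whole test and its running time -/

section

variable {tm : FinTM2} (e : tm.Γ tm.k₀ ≃ Option Bool) (no : tm.Γ tm.k₁) (p q r : ℕ) (T : Bool → ℕ)

theorem update_nil_inl (k : tm.K) (x : List (tm.Γ k)) :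
    (Function.update (fun _ => []) (Sum.inl k) x :
        ∀ j : tm.K ⊕ WorkStack, List (Sum.elim tm.Γ (fun _ => Option Bool) j)) =
      joinStk (Function.update (fun _ => []) k x) (workStk [] [] []) := by
  rw [← update_joinStk_inl]
  congr 1
  funext j
  rcases j with j | j
  · rfl
  · cases j <;> rfl

theorem initList_testMachine (w : List (tm.Γ tm.k₀)) :
    initList (testMachine tm e no p q r T) w =
      testCfg .read none (fun s => Fin.last (T s)) 0 0 w [] [] :=
  (initList_eq _ _).trans (congrArg (TM2.Cfg.mk _ _) (update_nil_inl ..))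

theorem haltList_testMachine (w : List (tm.Γ tm.k₁)) :
    haltList (testMachine tm e no p q r T) w =
      ⟨none, (tm.initialState, fullControl T),
        joinStk (Function.update (fun _ => []) tm.k₁ w) (workStk [] [] [])⟩ :=
  (haltList_eq _ _).trans (congrArg (TM2.Cfg.mk _ _) (update_nil_inl ..))

/-- The test, up to the decision. -/
theorem reachesWithin_test (φ : Formula) :
    ∃ b : ∀ s, Fin (T s + 1), ReachesWithin (testStep tm e no p q r T)
      ((encodeFormula φ).length * (2 * (encodeFormula φ).length + 3) +
        (r + 2) * (encodeFormula φ).length + 4)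
      (testCfg .read none (fun s => Fin.last (T s)) 0 0 ((encodeFormula φ).map e.symm) [] [])
      (cond (decide (passes p q r T φ))
        ⟨some (Sum.inl tm.main), (tm.initialState, fullControl T),
          joinStk (Function.update (fun _ => []) tm.k₀ ((encodeFormula φ).map e.symm))
            (workStk [] [] [])⟩
        ⟨some (Sum.inr .wipe), (tm.initialState, none, b, decide (passes p q r T φ)),
          joinStk (Function.update (fun _ => []) tm.k₀ ((encodeFormula φ).map e.symm))
            (workStk [] [] [])⟩) := by
  have hlen : (revWord (litList φ).reverse φ.n).length = (encodeFormula φ).length := by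
    rw [← reverse_encodeFormula, List.length_reverse]
  have hn : φ.n ≤ (encodeFormula φ).length := by simp [encodeFormula_eq]
  have h₁ := reachesWithin_read e no p q r none (fun s => Fin.last (T s)) 0 [] []
    (encodeFormula φ)
  have h₂ := reachesWithin_restore e no p q r none (fun s => Fin.last (T s))
    (0 + r * (encodeFormula φ).countP Option.isSome) 0 [] ((encodeFormula φ).reverse ++ [])
    ((encodeFormula φ).reverse ++ [])
  obtain ⟨b, h₃⟩ := reachesWithin_rounds e no p q r none (fun s => Fin.last (T s))
    (0 + r * (encodeFormula φ).countP Option.isSome) 0 ((encodeFormula φ).map e.symm)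
    (encodeFormula φ).length φ.n (litList φ).reverse
    (fun x hx => lt_of_mem_litList φ (List.mem_reverse.1 hx)) hlen.le
  have h₄ := reachesWithin_clear e no p q r none b [] []
    (List.replicate (r * (3 * φ.m) - (p * φ.n + q * excess T φ)) none)
    (decide (passes p q r T φ)) (Function.update (fun _ => []) tm.k₀ ((encodeFormula φ).map e.symm))
  have hlen' : (List.replicate (r * (3 * φ.m) - (p * φ.n + q * excess T φ))
      (none : Option Bool)).length ≤ r * (encodeFormula φ).length := by
    rw [List.length_replicate]
    refine (Nat.sub_le _ _).trans (Nat.mul_le_mul_left _ ?_)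
    rw [← countP_isSome_encodeFormula]
    exact List.countP_le_length
  simp only [sum_count_litList] at h₃
  simp only [List.append_nil, List.reverse_reverse, zero_add] at h₁ h₂ h₃
  rw [← reverse_encodeFormula, countP_isSome_encodeFormula] at h₃
  rw [countP_isSome_encodeFormula] at h₁ h₂
  refine ⟨b, (((h₁.trans h₂).trans h₃).trans h₄).mono ?_⟩
  have := Nat.mul_le_mul_right (2 * (encodeFormula φ).length + 3) hn
  rw [List.length_reverse]
  linarith

end

/-- Polynomial time algorithms can be combined with the test. -/
theorem IsPolyTime.and_passes {A : Formula → Bool} (hA : IsPolyTime A) (p q r : ℕ)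
    (T : Bool → ℕ) : IsPolyTime fun φ => decide (passes p q r T φ) && A φ := by
  obtain ⟨h⟩ := hA
  refine ⟨{
    -- A failed test answers `false`, which is always sound.
    tm := testMachine h.tm h.inputAlphabet (h.outputAlphabet.symm false) p q r T
    inputAlphabet := h.inputAlphabet
    outputAlphabet := h.outputAlphabet
    -- The bound of `reachesWithin_test`, plus `X + 1` for wiping the input and `h.time` for the
    -- original machine; only one of the last two is needed in each run.
    time := h.time + (Polynomial.X * (2 * Polynomial.X + 3) +
        ((r : Polynomial ℕ) + 3) * Polynomial.X + 5)
    outputsFun := fun φ => Classical.choice ?_ }⟩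
  rw [nonempty_outputsInTime_iff]
  have hrun := (nonempty_outputsInTime_iff ..).1 ⟨h.outputsFun φ⟩
  obtain ⟨b, h₁⟩ := reachesWithin_test h.inputAlphabet (h.outputAlphabet.symm false) p q r T φ
  have key : ReachesWithin (testStep h.tm h.inputAlphabet (h.outputAlphabet.symm false) p q r T)
      (h.time.eval (encodeFormula φ).length + ((encodeFormula φ).length *
        (2 * (encodeFormula φ).length + 3) + (r + 3) * (encodeFormula φ).length + 5))
      (testCfg .read none (fun s => Fin.last (T s)) 0 0
        ((encodeFormula φ).map h.inputAlphabet.symm) [] [])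
      ⟨none, (h.tm.initialState, fullControl T),
        joinStk (Function.update (fun _ => []) h.tm.k₁
          [h.outputAlphabet.symm (decide (passes p q r T φ) && A φ)]) (workStk [] [] [])⟩ := by
    by_cases hp : passes p q r T φ
    · simp only [hp, decide_true, cond_true, Bool.true_and] at h₁ ⊢
      rw [initList_eq, haltList_eq] at hrun
      have h₂ := hrun.liftCfg (M' := Sum.elim (fun l => liftStmt (h.tm.m l))
        (testProgram h.inputAlphabet (h.outputAlphabet.symm false) p q r)) (fun _ => rfl)
        (fullControl T) (workStk [] [] [])
      refine (h₁.trans h₂).mono ?_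
      nlinarith
    · simp only [hp, decide_false, cond_false, Bool.false_and] at h₁ ⊢
      refine (h₁.trans (reachesWithin_wipe ..)).mono ?_
      simp only [List.length_map]
      nlinarith
  have h₂ := initList_testMachine h.inputAlphabet (h.outputAlphabet.symm false) p q r T
    ((encodeFormula φ).map h.inputAlphabet.symm)
  have h₃ := haltList_testMachine h.inputAlphabet (h.outputAlphabet.symm false) p q r T
    [h.outputAlphabet.symm (decide (passes p q r T φ) && A φ)]
  refine cast (congrArg₂ (ReachesWithin (testStep h.tm h.inputAlphabet
    (h.outputAlphabet.symm false) p q r T) _) h₂ h₃).symm (key.mono (le_of_eq ?_))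
  simp

end UnbalancedCSP

namespace UnbalancedCSP

/-! ### Soundness of the test -/

/-- The number of literals of a formula that are false under an assignment. -/
def falseCount (φ : Formula) (ψ : Fin φ.n → Bool) : ℕ :=
  (Finset.univ.filter fun x : Fin φ.m × Fin 3 => (φ.clause x.1 x.2).val ψ = false).card

theorem falseCount_eq_sum_occ (φ : Formula) (ψ : Fin φ.n → Bool) :
    falseCount φ ψ = ∑ l ∈ Finset.univ.filter (fun l : Literal φ.n => l.val ψ = false), occ φ l := by
  rw [falseCount, Finset.card_eq_sum_card_fiberwise (f := fun x => φ.clause x.1 x.2)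
    (t := Finset.univ.filter fun l : Literal φ.n => l.val ψ = false) (fun x hx => by simpa using hx)]
  refine Finset.sum_congr rfl fun l hl => ?_
  rw [occ, Finset.filter_filter]
  congr 1
  ext x
  simp only [Finset.mem_filter, Finset.mem_univ, true_and] at hl ⊢
  exact ⟨fun h => h.2, fun h => ⟨h ▸ hl, h⟩⟩

/-- Each variable has exactly one false literal, the positive one if its value is `false`.
Occurrences up to the threshold give the sum, the rest is part of the excess. -/
theorem falseCount_le (T : Bool → ℕ) (φ : Formula) (ψ : Fin φ.n → Bool) :
    falseCount φ ψ ≤ (∑ v, if ψ v = false then T true else T false) + excess T φ := by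
  have h : ∑ v, (if ψ v = false then T true else T false) =
      ∑ l ∈ Finset.univ.filter (fun l : Literal φ.n => l.val ψ = false), T l.2 := by
    rw [Finset.sum_filter, Fintype.sum_prod_type]
    refine Finset.sum_congr rfl fun v _ => ?_
    cases h : ψ v <;> simp [Literal.val, h]
  rw [falseCount_eq_sum_occ, h, excess]
  calc _ ≤ ∑ l ∈ Finset.univ.filter (fun l : Literal φ.n => l.val ψ = false),
        (T l.2 + (occ φ l - T l.2)) := Finset.sum_le_sum fun l _ => by omega
    _ ≤ _ := by
      rw [Finset.sum_add_distrib]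
      gcongr
      exact Finset.subset_univ _

/-- As `T false ≤ T true`, the threshold sum is largest when a full `γ` fraction of the variables is
`0`. This makes the bound uniform in `ψ`. -/
theorem falseCount_le_of_passes {γ : ℝ} {p q r : ℕ} {T : Bool → ℕ} (hT : T false ≤ T true)
    (hp : q * (γ * T true + (1 - γ) * T false) ≤ p) {φ : Formula} (h : passes p q r T φ)
    {ψ : Fin φ.n → Bool} (hψ : IsBiased γ ψ) : (q * falseCount φ ψ : ℝ) ≤ 3 * r * φ.m := by
  have h₁ : (falseCount φ ψ : ℝ) ≤
      ((∑ v, if ψ v = false then T true else T false : ℕ) : ℝ) + excess T φ := by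
    exact_mod_cast falseCount_le T φ ψ
  have h₂ : (p * φ.n + q * excess T φ : ℝ) ≤ r * (3 * φ.m) := by exact_mod_cast h
  have h₃ : ((∑ v, if ψ v = false then T true else T false : ℕ) : ℝ) ≤
      (γ * T true + (1 - γ) * T false) * φ.n := by
    have hcard := Finset.card_filter_add_card_filter_not (s := (Finset.univ : Finset (Fin φ.n)))
      (fun v => ψ v = false)
    have hcard' : ((Finset.univ.filter fun v => ψ v = false).card : ℝ) +
        (Finset.univ.filter fun v => ¬ ψ v = false).card = φ.n := by
      rw [← Nat.cast_add, hcard]; simp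
    rw [Finset.sum_ite, Finset.sum_const, Finset.sum_const, smul_eq_mul, smul_eq_mul]
    push_cast
    have hT' : (T false : ℝ) ≤ T true := by exact_mod_cast hT
    unfold IsBiased at hψ
    nlinarith [mul_le_mul_of_nonneg_right hψ (sub_nonneg.2 hT')]
  have hq : (0 : ℝ) ≤ q := Nat.cast_nonneg q
  have hn : (0 : ℝ) ≤ φ.n := Nat.cast_nonneg _
  calc (q * falseCount φ ψ : ℝ)
      ≤ q * ((γ * T true + (1 - γ) * T false) * φ.n + excess T φ) := by gcongr; linarith
    _ = q * (γ * T true + (1 - γ) * T false) * φ.n + q * excess T φ := by ring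
    _ ≤ p * φ.n + q * excess T φ := by gcongr
    _ ≤ 3 * r * φ.m := by linarith

/-- A satisfied `3`-XOR clause with a false literal has exactly two false literals. -/
theorem two_mul_satCount_xor3_le (φ : Formula) (ψ : Fin φ.n → Bool) :
    2 * satCount xor3 φ ψ ≤ 2 * satCount and3 φ ψ + falseCount φ ψ := by
  simp only [satCount, falseCount, Finset.card_filter, Fintype.sum_prod_type, Finset.mul_sum,
    ← Finset.sum_add_distrib]
  refine Finset.sum_le_sum fun j _ => ?_
  rw [Fin.sum_univ_three]
  simp only [xor3, and3]
  have h : ∀ a b c : Bool, (2 * if (a ^^ (b ^^ c)) = true then 1 else 0) ≤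
      (2 * if (a && b && c) = true then 1 else 0) + (((if a = false then 1 else 0) +
        if b = false then 1 else 0) + if c = false then 1 else 0) := by decide
  exact h _ _ _

theorem IsSatisfiable.and3_of_xor3 {γ s s' : ℝ} {p q r : ℕ} {T : Bool → ℕ} {φ : Formula}
    (hφ : IsSatisfiable xor3 γ s φ) (hT : T false ≤ T true) (hq : 0 < q)
    (hp : q * (γ * T true + (1 - γ) * T false) ≤ p) (h : passes p q r T φ)
    (hs : q * s' + 3 / 2 * r ≤ q * s) : IsSatisfiable and3 γ s' φ := by
  obtain ⟨ψ, hψ, hsat⟩ := hφ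
  refine ⟨ψ, hψ, ?_⟩
  have h₁ := falseCount_le_of_passes hT hp h hψ
  have h₂ : (2 * satCount xor3 φ ψ : ℝ) ≤ 2 * satCount and3 φ ψ + falseCount φ ψ := by
    exact_mod_cast two_mul_satCount_xor3_le φ ψ
  have hq' : (0 : ℝ) < q := by exact_mod_cast hq
  have hm : (0 : ℝ) ≤ φ.m := Nat.cast_nonneg _
  refine le_of_mul_le_mul_left ?_ hq'
  nlinarith [mul_le_mul_of_nonneg_right hs hm, mul_le_mul_of_nonneg_left hsat hq'.le,
    mul_le_mul_of_nonneg_left h₂ hq'.le]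

end UnbalancedCSP

namespace UnbalancedCSP

open ProbabilityTheory

/-! ### Random formulas pass the test -/

/-- The probability that a random literal has a given sign. -/
def signWeight (β : ℝ) (s : Bool) : ℝ := if s then 1 - β else β

section

variable {β : ℝ} {n : ℕ}

theorem isProbabilityMeasure_literalLaw (h₀ : 0 ≤ β) (h₁ : β ≤ 1) (hn : n ≠ 0) :
    IsProbabilityMeasure (literalLaw β n) := by
  have : NeZero n := ⟨hn⟩
  have : IsProbabilityMeasure
      (ENNReal.ofReal β • Measure.dirac false + ENNReal.ofReal (1 - β) • Measure.dirac true) := by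
    constructor
    simp [← ENNReal.ofReal_add h₀ (sub_nonneg.2 h₁)]
  unfold literalLaw
  infer_instance

theorem literalLaw_real_singleton (h₀ : 0 ≤ β) (h₁ : β ≤ 1) (hn : n ≠ 0) (l : Literal n) :
    (literalLaw β n).real {l} = signWeight β l.2 / n := by
  have : NeZero n := ⟨hn⟩
  obtain ⟨v, s⟩ := l
  rw [Measure.real, literalLaw, ← Set.singleton_prod_singleton, Measure.prod_prod, uniformOn_univ]
  cases s <;> simp [signWeight, h₀, h₁, div_eq_inv_mul]

theorem literalLaw_real_finset (h₀ : 0 ≤ β) (h₁ : β ≤ 1) (hn : n ≠ 0) (S : Finset (Literal n)) :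
    (literalLaw β n).real S = (∑ l ∈ S, signWeight β l.2) / n := by
  have := isProbabilityMeasure_literalLaw h₀ h₁ hn
  rw [← sum_measureReal_singleton, Finset.sum_div]
  exact Finset.sum_congr rfl fun l _ => literalLaw_real_singleton h₀ h₁ hn l

/-- Large deviations of the number of literals in a given set. -/
theorem formulaLaw_real_ge_le (h₀ : 0 ≤ β) (h₁ : β ≤ 1) (hn : n ≠ 0) (m : ℕ)
    (S : Finset (Literal n)) {t : ℝ} (ht : 0 ≤ t) :
    (formulaLaw β n m).real {c | 3 * m * (literalLaw β n).real S + t ≤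
      ∑ j, ∑ i, if c j i ∈ S then (1 : ℝ) else 0} ≤ Real.exp (-(2 * t ^ 2 / (9 * m))) := by
  have := isProbabilityMeasure_literalLaw h₀ h₁ hn
  set μ := literalLaw β n
  set ν : Measure (Fin 3 → Literal n) := Measure.pi fun _ => μ
  have : IsProbabilityMeasure (formulaLaw β n m) := by unfold formulaLaw; infer_instance
  -- Hoeffding is applied to whole clauses: `m` independent variables in `[0, 3]`, each with
  -- variance proxy `9/4`, hence the exponent `2t²/(9m)`.
  let Y : (Fin 3 → Literal n) → ℝ := fun x => ∑ i, if x i ∈ S then (1 : ℝ) else 0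
  have hY : Measurable Y := measurable_of_countable _
  have hmean : ∫ x, Y x ∂ν = 3 * μ.real S := by
    have h (i : Fin 3) : ∫ x, (if x i ∈ S then (1 : ℝ) else 0) ∂ν = μ.real S := by
      rw [integral_comp_eval (μ := fun _ : Fin 3 => μ) (i := i)
        (f := fun l => if l ∈ S then (1 : ℝ) else 0) (by fun_prop)]
      rw [← integral_indicator_one S.measurableSet]
      congr 1
      funext l
      simp [Set.indicator_apply]
    rw [integral_finsetSum _ fun i _ => .of_finite]
    simp [h]
  have hindep : iIndepFun (fun j (c : Fin m → Fin 3 → Literal n) => Y (c j) - 3 * μ.real S)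
      (formulaLaw β n m) :=
    iIndepFun_pi (X := fun _ x => Y x - 3 * μ.real S) fun j =>
      (measurable_of_countable _).aemeasurable
  have hsub (j : Fin m) : HasSubgaussianMGF
      (fun c : Fin m → Fin 3 → Literal n => Y (c j) - 3 * μ.real S)
      ((‖(3 : ℝ) - 0‖₊ / 2) ^ 2) (formulaLaw β n m) := by
    have hint : ∫ c, Y (c j) ∂(formulaLaw β n m) = 3 * μ.real S := by
      rw [← hmean]
      exact integral_comp_eval (μ := fun _ : Fin m => ν) (i := j) (f := Y) (by fun_prop)
    have := hasSubgaussianMGF_of_mem_Icc (μ := formulaLaw β n m) (X := fun c => Y (c j))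
      (a := 0) (b := 3) (measurable_of_countable _).aemeasurable (ae_of_all _ fun c => by
        constructor
        · exact Finset.sum_nonneg fun i _ => by split_ifs <;> norm_num
        · refine (Finset.sum_le_sum (g := fun _ => 1) fun i _ => ?_).trans (by simp)
          split_ifs <;> norm_num)
    rwa [hint] at this
  have h := HasSubgaussianMGF.measure_sum_ge_le_of_iIndepFun hindep (s := Finset.univ)
    (fun j _ => hsub j) ht
  convert! h using 2
  · congr 1
    ext c
    simp only [Finset.sum_sub_distrib, Finset.sum_const, Finset.card_univ, Fintype.card_fin,
      nsmul_eq_mul]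
    constructor <;> intro h <;> linarith
  · simp
    ring

end

end UnbalancedCSP

namespace UnbalancedCSP

open ProbabilityTheory

theorem sum_occ_eq (φ : Formula) (S : Finset (Literal φ.n)) :
    ((∑ l ∈ S, occ φ l : ℕ) : ℝ) = ∑ j, ∑ i, if φ.clause j i ∈ S then (1 : ℝ) else 0 := by
  simp only [occ, Finset.card_filter, Fintype.sum_prod_type]
  rw [Finset.sum_comm]
  push_cast
  refine Finset.sum_congr rfl fun j _ => ?_
  rw [Finset.sum_comm]
  refine Finset.sum_congr rfl fun i _ => ?_
  simp

/-- A formula that fails the test has a set of literals occurring much more often than expected. -/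
theorem exists_finset_of_not_passes {β Δ η : ℝ} (h₀ : 0 ≤ β) (h₁ : β ≤ 1) {p q r : ℕ}
    {T : Bool → ℕ} (hT : ∀ s, 3 * Δ * signWeight β s ≤ T s) {φ : Formula} (hn : φ.n ≠ 0)
    (hm : φ.m ≤ Δ * φ.n) (hq : 0 < q) (hη : p * φ.n + q * (η * φ.m) ≤ r * (3 * φ.m))
    (h : ¬ passes p q r T φ) : ∃ S : Finset (Literal φ.n),
      3 * φ.m * (literalLaw β φ.n).real S + η * φ.m ≤
        ∑ j, ∑ i, if φ.clause j i ∈ S then (1 : ℝ) else 0 := by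
  -- The overfull literals carry the entire excess, and there the thresholds dominate the expected
  -- counts.
  let S : Finset (Literal φ.n) := Finset.univ.filter fun l => T l.2 < occ φ l
  refine ⟨S, ?_⟩
  have hn' : (0 : ℝ) < φ.n := by exact_mod_cast Nat.pos_of_ne_zero hn
  have hq' : (0 : ℝ) < q := by exact_mod_cast hq
  have hexc : η * φ.m ≤ excess T φ := by
    have h' : (r * (3 * φ.m) : ℝ) < p * φ.n + q * excess T φ := by exact_mod_cast not_le.1 h
    exact (lt_of_mul_lt_mul_left (by linarith : q * (η * φ.m) < q * (excess T φ : ℝ)) hq'.le).le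
  have hsum : (excess T φ : ℝ) + ∑ l ∈ S, (T l.2 : ℝ) = ((∑ l ∈ S, occ φ l : ℕ) : ℝ) := by
    have : excess T φ + ∑ l ∈ S, T l.2 = ∑ l ∈ S, occ φ l := by
      have : excess T φ = ∑ l ∈ S, (occ φ l - T l.2) := by
        rw [Finset.sum_filter]
        refine Finset.sum_congr rfl fun l _ => ?_
        split_ifs <;> omega
      rw [this, ← Finset.sum_add_distrib]
      refine Finset.sum_congr rfl fun l hl => ?_
      have := (Finset.mem_filter.1 hl).2
      omega
    exact_mod_cast this
  rw [← sum_occ_eq, ← hsum, literalLaw_real_finset h₀ h₁ hn]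
  have hw : 0 ≤ ∑ l ∈ S, signWeight β l.2 := Finset.sum_nonneg fun l _ => by
    unfold signWeight; split_ifs <;> linarith
  have hTS : 3 * Δ * ∑ l ∈ S, signWeight β l.2 ≤ ∑ l ∈ S, (T l.2 : ℝ) := by
    rw [Finset.mul_sum]
    exact Finset.sum_le_sum fun l _ => hT l.2
  have : 3 * φ.m * ((∑ l ∈ S, signWeight β l.2) / φ.n) ≤ 3 * Δ * ∑ l ∈ S, signWeight β l.2 := by
    calc 3 * φ.m * ((∑ l ∈ S, signWeight β l.2) / φ.n)
        ≤ 3 * (Δ * φ.n) * ((∑ l ∈ S, signWeight β l.2) / φ.n) := by gcongr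
      _ = _ := by field_simp
  linarith

/-- Random formulas fail the test with exponentially small probability. -/
theorem formulaLaw_real_not_passes_le {β Δ η : ℝ} (h₀ : 0 ≤ β) (h₁ : β ≤ 1) {p q r : ℕ}
    {T : Bool → ℕ} (hT : ∀ s, 3 * Δ * signWeight β s ≤ T s) {n m : ℕ} (hn : n ≠ 0) (hm₀ : m ≠ 0)
    (hm : m ≤ Δ * n) (hq : 0 < q) (hη₀ : 0 ≤ η) (hη : p * n + q * (η * m) ≤ r * (3 * m))
    (hlarge : 27 * n ≤ 2 * η ^ 2 * m) :
    (formulaLaw β n m).real {c | ¬ passes p q r T ⟨n, m, c⟩} ≤ Real.exp (-n) := by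
  have := isProbabilityMeasure_literalLaw h₀ h₁ hn
  have : IsProbabilityMeasure (formulaLaw β n m) := by unfold formulaLaw; infer_instance
  have hm' : (0 : ℝ) < m := by exact_mod_cast Nat.pos_of_ne_zero hm₀
  calc (formulaLaw β n m).real {c | ¬ passes p q r T ⟨n, m, c⟩}
      ≤ (formulaLaw β n m).real (⋃ S : Finset (Literal n),
          {c | 3 * m * (literalLaw β n).real S + η * m ≤
            ∑ j, ∑ i, if c j i ∈ S then (1 : ℝ) else 0}) := by
        refine measureReal_mono fun c hc => ?_
        obtain ⟨S, hS⟩ := exists_finset_of_not_passes h₀ h₁ (φ := ⟨n, m, c⟩) hT hn hm hq hη hc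
        exact Set.mem_iUnion.2 ⟨S, hS⟩
    _ ≤ ∑ S : Finset (Literal n), Real.exp (-(2 * (η * m) ^ 2 / (9 * m))) :=
        (measureReal_iUnion_fintype_le _).trans
          (Finset.sum_le_sum fun S _ => formulaLaw_real_ge_le h₀ h₁ hn m S (by positivity))
    -- `hlarge` is this inequality of exponents: `2η²m/9 ≥ 3n`, enough to beat the `4^n` sets.
    _ ≤ ∑ S : Finset (Literal n), Real.exp (-(3 * n)) := by
        gcongr
        rw [le_div_iff₀ (by positivity)]
        nlinarith
    _ = 2 ^ (2 * n) * Real.exp (-(3 * n)) := by simp [mul_comm]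
    _ ≤ Real.exp (2 * n) * Real.exp (-(3 * n)) := by
        gcongr
        rw [show (2 * n : ℝ) = ((2 * n : ℕ) : ℝ) * 1 by push_cast; ring, Real.exp_nat_mul]
        gcongr
        linarith [Real.add_one_le_exp 1]
    _ = Real.exp (-n) := by rw [← Real.exp_add]; ring_nf

/-! ### The reduction -/

/-- Notions of "most" that are not affected by an error that tends to zero. -/
def StableUnderNull (most : (ℕ → ℝ) → Prop) : Prop :=
  ∀ u u' e : ℕ → ℝ, Tendsto e atTop (𝓝 0) → (∀ᶠ n in atTop, u n ≤ u' n + e n) →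
    (∀ᶠ n in atTop, u' n ≤ 1) → most u → most u'

theorem stableUnderNull_almostAll : StableUnderNull AlmostAll := by
  intro u u' e he hu hu' h
  have : Tendsto (fun n => u n - e n) atTop (𝓝 1) := by simpa using Tendsto.sub h he
  refine tendsto_of_tendsto_of_tendsto_of_le_of_le' this tendsto_const_nhds ?_ hu'
  filter_upwards [hu] with n hn
  linarith

theorem stableUnderNull_majority : StableUnderNull Majority := by
  rintro u u' e he hu - ⟨δ, hδ, h⟩
  refine ⟨δ / 2, by positivity, ?_⟩
  filter_upwards [hu, h, he.eventually (gt_mem_nhds (half_pos hδ))] with n h₁ h₂ h₃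
  linarith

/-- Suitable parameters of the test. -/
theorem exists_test_parameters {β γ ε Δ : ℝ} (hγ : 0 < γ) (hγβ : γ < β) (hβ : β < 1 / 2)
    (hε : 0 < ε) (hΔ : 0 ≤ Δ) : ∃ (p q r : ℕ) (T : Bool → ℕ), 0 < q ∧ T false ≤ T true ∧
      (∀ s, 3 * Δ * signWeight β s ≤ T s) ∧
      q * (γ * T true + (1 - γ) * T false) ≤ p ∧
      (p : ℝ) ≤ q * (3 * Δ * (β + γ - 2 * β * γ) + 2) ∧
      (3 * r : ℝ) ≤ q * (3 * (β + γ - 2 * β * γ) + ε) ∧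
      q * (3 * (β + γ - 2 * β * γ) + ε / 2) ≤ (3 * r : ℝ) := by
  set α := β + γ - 2 * β * γ with hα
  have hα₀ : 0 ≤ α := by nlinarith
  -- Rounding `r` down changes `3r` by at most `3`, which is less than `qε/2`.
  obtain ⟨q, hq⟩ := exists_nat_gt (6 / ε)
  have hq₀ : (0 : ℝ) < q := lt_trans (by positivity) hq
  have hqε : 6 < q * ε := (div_lt_iff₀ hε).1 hq
  have hq₁ : (1 : ℝ) ≤ q := by exact_mod_cast (Nat.cast_pos.1 hq₀ : 0 < q)
  -- The thresholds are expected counts rounded up; their `γ`-average is at most `3Δα + 1`. Rounding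
  -- `p` up adds at most `1 ≤ q`, whence the `2` in the bound on `p`.
  refine ⟨⌈q * (3 * Δ * α + 1)⌉₊, q, ⌊q * (α + ε / 3)⌋₊, fun s => ⌈3 * Δ * signWeight β s⌉₊,
    by exact_mod_cast hq₀, Nat.ceil_le_ceil ?_, fun s => Nat.le_ceil _, ?_, ?_, ?_, ?_⟩
  · simp only [signWeight]
    gcongr
    simp only [Bool.false_eq_true, if_false, if_true]
    linarith
  · refine le_trans ?_ (Nat.le_ceil _)
    have h (s : Bool) : (⌈3 * Δ * signWeight β s⌉₊ : ℝ) ≤ 3 * Δ * signWeight β s + 1 :=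
      (Nat.ceil_lt_add_one (mul_nonneg (by positivity)
        (by unfold signWeight; split_ifs <;> linarith))).le
    have h₁ := h true
    have h₂ := h false
    simp only [signWeight, Bool.false_eq_true, if_false, if_true] at h₁ h₂ ⊢
    refine mul_le_mul_of_nonneg_left ?_ hq₀.le
    have h₃ := mul_le_mul_of_nonneg_left h₁ hγ.le
    have h₄ := mul_le_mul_of_nonneg_left h₂ (by linarith : 0 ≤ 1 - γ)
    rw [hα]
    linarith
  · have := (Nat.ceil_lt_add_one (by positivity : 0 ≤ q * (3 * Δ * α + 1))).le
    linarith
  · have := Nat.floor_le (by positivity : 0 ≤ q * (α + ε / 3))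
    linarith
  · have := (Nat.lt_floor_add_one (q * (α + ε / 3))).le
    linarith

/-- The new algorithm misses a formula refuted by `A` only if the test fails, an event of
probability at most `e^(-n)`. -/
theorem HasRefuter.xor3_of_and3 {most : (ℕ → ℝ) → Prop} (hmost : StableUnderNull most)
    {γ β ε Δ : ℝ} (hγ : 0 < γ) (hγβ : γ < β) (hβ : β < 1 / 2) (hε : 0 < ε)
    (hΔ : 1 + 20 / ε + 216 / ε ^ 2 ≤ Δ)
    (h : HasRefuter most and3 γ β (1 - 3 / 2 * (β + γ - 2 * β * γ) - ε) Δ) :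
    HasRefuter most xor3 γ β (1 - ε / 2) Δ := by
  obtain ⟨A, hA, hsound, hcomplete⟩ := h
  have hε₁ : 0 < 20 / ε := by positivity
  have hε₂ : 0 < 216 / ε ^ 2 := by positivity
  obtain ⟨p, q, r, T, hq, hT, hTw, hp, hp', hr, hr'⟩ :=
    exists_test_parameters hγ hγβ hβ hε (by linarith : 0 ≤ Δ)
  set α := β + γ - 2 * β * γ with hα
  refine ⟨_, hA.and_passes p q r T, fun φ hφ => ?_, ?_⟩
  · by_cases hpass : passes p q r T φ
    -- The XOR deficit `ε/2` and half of the tolerance `3r/q ≤ 3α + ε` add up to `3α/2 + ε`.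
    · have := hφ.and3_of_xor3 (s' := 1 - 3 / 2 * α - ε) hT hq hp hpass (by linarith)
      simp [hsound φ this]
    · simp [hpass]
  · refine hmost _ _ (fun n => Real.exp (-n)) ?_ ?_ ?_ hcomplete
    · exact Real.tendsto_exp_neg_atTop_nhds_zero.comp tendsto_natCast_atTop_atTop
    · filter_upwards [eventually_ge_atTop 1] with n hn
      have hn' : (1 : ℝ) ≤ n := by exact_mod_cast hn
      set m := ⌊Δ * n⌋₊ with hmdef
      have hm : (m : ℝ) ≤ Δ * n := Nat.floor_le (by nlinarith)
      have hm' : (Δ - 1) * n ≤ m := by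
        have := (Nat.lt_floor_add_one (Δ * n)).le
        linarith
      have hm₁ : 20 * n ≤ ε * m := by
        have : 20 ≤ ε * (Δ - 1) := by
          have := mul_le_mul_of_nonneg_left (by linarith : 20 / ε ≤ Δ - 1) hε.le
          rwa [mul_div_cancel₀ _ hε.ne'] at this
        nlinarith
      -- This is `27n ≤ 2η²m` for `η = ε/4`.
      have hm₂ : 216 * n ≤ ε ^ 2 * m := by
        have : 216 ≤ ε ^ 2 * (Δ - 1) := by
          have := mul_le_mul_of_nonneg_left (by linarith : 216 / ε ^ 2 ≤ Δ - 1) (sq_nonneg ε)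
          rwa [mul_div_cancel₀ _ (by positivity)] at this
        nlinarith [sq_nonneg ε]
      have hm₀ : m ≠ 0 := by
        intro h0
        rw [h0] at hm₁
        push_cast at hm₁
        linarith
      have hq' : (0 : ℝ) < q := by exact_mod_cast hq
      have hα₁ : α ≤ 1 := by nlinarith
      have hα₀ : 0 ≤ α := by nlinarith
      have hη : (p * n + q * (ε / 4 * m) : ℝ) ≤ r * (3 * m) := by
        have e₁ : (p * n : ℝ) ≤ q * (3 * Δ * α + 2) * n := by gcongr
        have e₂ : q * (3 * α + ε / 2) * m ≤ (3 * r * m : ℝ) := by gcongr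
        -- Since `Δn ≤ m + n` and `α ≤ 1`, the rounding terms amount to at most `5n`, and `20n ≤ εm`
        -- absorbs them in the remaining `εm/4`.
        have e₃ : (3 * Δ * α + 2) * n + ε / 4 * m ≤ (3 * α + ε / 2) * m := by
          nlinarith [mul_le_mul_of_nonneg_left hm' hα₀,
            mul_le_mul_of_nonneg_right hα₁ (by linarith : (0 : ℝ) ≤ n)]
        have e₄ := mul_le_mul_of_nonneg_left e₃ hq'.le
        linarith
      have := isProbabilityMeasure_literalLaw (β := β) (n := n) (by linarith) (by linarith)
        (by omega)
      have : IsProbabilityMeasure (formulaLaw β n m) := by unfold formulaLaw; infer_instance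
      have hfail := formulaLaw_real_not_passes_le (by linarith) (by linarith) hTw (n := n) (m := m)
        (by omega) hm₀ hm hq (by positivity) hη (by nlinarith)
      refine le_trans ?_ (add_le_add_right hfail _)
      refine (measureReal_mono fun c hc => ?_).trans (measureReal_union_le _ _)
      by_cases hpass : passes p q r T ⟨n, m, c⟩
      · left
        simpa [hpass] using hc
      · right
        exact hpass
    · filter_upwards [eventually_ge_atTop 1] with n hn
      have := isProbabilityMeasure_literalLaw (β := β) (n := n) (by linarith) (by linarith)
        (by omega)
      have : IsProbabilityMeasure (formulaLaw β n ⌊Δ * n⌋₊) := by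
        unfold formulaLaw; infer_instance
      exact measureReal_le_one

theorem XorRefutationHard.andRefutationHard {most : (ℕ → ℝ) → Prop} (hmost : StableUnderNull most)
    {γ β : ℝ} (hγ : 0 < γ) (hγβ : γ < β) (hβ : β < 1 / 2) (h : XorRefutationHard most γ β) :
    AndRefutationHard most γ β := by
  intro ε hε
  obtain ⟨Δ₀, hΔ₀⟩ := h (ε / 2) (half_pos hε)
  refine ⟨max Δ₀ (1 + 20 / ε + 216 / ε ^ 2), fun Δ hΔ hand => ?_⟩
  exact hΔ₀ Δ ((le_max_left _ _).trans hΔ)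
    (hand.xor3_of_and3 hmost hγ hγβ hβ hε ((le_max_right _ _).trans hΔ))

end UnbalancedCSP

theorem theorem1 :
    (∀ γ β : ℝ, 0 < γ → γ < β → β < 1 / 2 →
      UnbalancedCSP.XorRefutationHard UnbalancedCSP.AlmostAll γ β →
        UnbalancedCSP.AndRefutationHard UnbalancedCSP.AlmostAll γ β) ∧
    (∀ γ β : ℝ, 0 < γ → γ < β → β < 1 / 2 →
      UnbalancedCSP.XorRefutationHard UnbalancedCSP.Majority γ β →
        UnbalancedCSP.AndRefutationHard UnbalancedCSP.Majority γ β) :=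
  ⟨fun _ _ h₁ h₂ h₃ h =>
    h.andRefutationHard UnbalancedCSP.stableUnderNull_almostAll h₁ h₂ h₃,
  fun _ _ h₁ h₂ h₃ h =>
    h.andRefutationHard UnbalancedCSP.stableUnderNull_majority h₁ h₂ h₃⟩
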